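/- A \emph{birestriction monoid} is an algebra $(S;\cdot,{}^*,{}^+,1)$ of type $(2,1,1,0)$ such that $(S;\cdot,1)$ is a monoid and $xx^*=x$, $x^*y^*=y^*x^*$, $(xy^*)^*=x^*y^*$, $x^*y=y(xy)^*$, $x^+x=x$, $x^+y^+=y^+x^+$, $(x^+y)^+=x^+y^+$, $xy^+=(xy)^+x$, $(x^+)^*=x^+$, $(x^*)^+=x^*$ hold. Its projections are the elements $s^*$; $s\le t$ means $s=et$ for some projection $e$; $s\mathrel{\sigma}t$ means $es=et$ for some projection $e$. It is \emph{$F$-birestriction} if every $\sigma$-class has a maximum element; $F$-birestriction monoids are considered with the additional unary operation that takes $s$ to the maximum of its $\sigma$-class. Every inverse monoid is a birestriction monoid via $x^*=x^{-1}x$, $x^+=xx^{-1}$; it is \emph{$E$-unitary} if every element above an idempotent is an idempotent. A $Y$-generated birestriction monoid $S$ \emph{admits a geometric model} if there is an injective $(2,1,1,0)$-morphism from $S$ to a $Y$-generated $E$-unitary inverse monoid which commutes with the assignment maps from $Y$. For a set $X$ with free semigroup $X^+$, let $\overline{X^+}=\{\overline{u}:u\in X^+\}$ be a disjoint copy of $X^+$,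 and let $N$ be the set of relations $x=\overline{x}\,x^*$ $(x\in X)$ and $\overline{u}\,\overline{v}=\overline{uv}\,(\overline{u}\,\overline{v})^*$ $(u,v\in X^+)$. Let $\mathcal F=\mathcal F_\varnothing$ be the birestriction monoid presented by the generators $X\cup\overline{X^+}$ and the relations $N$, and let $\mathcal I$ be its universal inverse monoid, i.e. the inverse monoid presented by the same generators and relations, where $t^*$ is read as $t^{-1}t$. \textbf{Proposition.} Let $X=\{x\}$. Then the $(X\cup\overline{X^+})$-generated birestriction monoid $\mathcal F$, which is the free $X$-generated $F$-birestriction monoid $\mathsf{FFBR}(X)$ via $x\mapsto x$, does not admit a geometric model. Moreover, the element $\overline{x}\;\overline{x^2}^{\,-1}\,\overline{x}$ of $\mathcal I$ has image $1$ under the canonical morphism from $\mathcal I$ to the free group $\mathsf{FG}(X)$ (given by $x\mapsto x$ and $\overline{u}\mapsto u$ for $u\in X^+$), but it is not an idempotent of $\mathcal I$. -/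

import Mathlib

universe u v

/-! # Birestriction monoids -/

/-- A birestriction monoid, as an algebra `(S; ·, *, +, 1)` of type `(2,1,1,0)`:
`rstar s` is `s^*` and `rplus s` is `s^+`. -/
class BirestrictionMonoid (S : Type u) extends Monoid S where
  rstar : S → S
  rplus : S → S
  mul_rstar_self : ∀ x : S, x * rstar x = x
  rstar_mul_comm : ∀ x y : S, rstar x * rstar y = rstar y * rstar x
  rstar_mul_rstar : ∀ x y : S, rstar (x * rstar y) = rstar x * rstar y
  rstar_mul : ∀ x y : S, rstar x * y = y * rstar (x * y)
  rplus_mul_self : ∀ x : S, rplus x * x = x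
  rplus_mul_comm : ∀ x y : S, rplus x * rplus y = rplus y * rplus x
  rplus_mul_rplus : ∀ x y : S, rplus (rplus x * y) = rplus x * rplus y
  mul_rplus : ∀ x y : S, x * rplus y = rplus (x * y) * x
  rstar_rplus : ∀ x : S, rstar (rplus x) = rplus x
  rplus_rstar : ∀ x : S, rplus (rstar x) = rstar x

namespace BirestrictionMonoid

/-- Projections: the elements of `P(S) = {s^* : s ∈ S} = {s^+ : s ∈ S}`. -/
def IsProjection {S : Type u} [BirestrictionMonoid S] (e : S) : Prop :=
  ∃ s : S, e = rstar s

/-- The natural partial order: `s ≤ t` iff `s = e t` for some projection `e`. -/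
def NatLE {S : Type u} [BirestrictionMonoid S] (s t : S) : Prop :=
  ∃ e : S, IsProjection e ∧ s = e * t

/-- The congruence `σ`: `s σ t` iff `e s = e t` for some projection `e`. -/
def Sigma {S : Type u} [BirestrictionMonoid S] (s t : S) : Prop :=
  ∃ e : S, IsProjection e ∧ e * s = e * t

/-- `m` is the maximum element of the `σ`-class of `s`. -/
def IsSigmaMax {S : Type u} [BirestrictionMonoid S] (s m : S) : Prop :=
  Sigma m s ∧ ∀ t : S, Sigma t s → NatLE t m

/-- Morphisms of type `(2,1,1,0)`: monoid morphisms which preserve `*` and `+`. -/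
structure IsBirestrictionHom {S : Type u} {T : Type v} [BirestrictionMonoid S]
    [BirestrictionMonoid T] (f : S →* T) : Prop where
  map_rstar : ∀ s : S, f (rstar s) = rstar (f s)
  map_rplus : ∀ s : S, f (rplus s) = rplus (f s)

/-- `S` is `Y`-generated (as an algebra of type `(2,1,1,0)`) via the assignment map `ι`. -/
def IsGenerated {Y : Type v} {S : Type u} [BirestrictionMonoid S] (ι : Y → S) : Prop :=
  ∀ A : Set S, (∀ y, ι y ∈ A) → (1 : S) ∈ A → (∀ s ∈ A, ∀ t ∈ A, s * t ∈ A) →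
    (∀ s ∈ A, rstar s ∈ A) → (∀ s ∈ A, rplus s ∈ A) → A = Set.univ

/-- `F`-birestriction monoids: every `σ`-class has a maximum element. -/
def IsFBirestriction (S : Type u) [BirestrictionMonoid S] : Prop :=
  ∀ s : S, ∃ m : S, IsSigmaMax s m

/-- `S` is the free `X`-generated `F`-birestriction monoid via `ι : X → S`: it is
`F`-birestriction, and every map from `X` to an `F`-birestriction monoid `T` extends to a
unique morphism of type `(2,1,1,1,0)`, i.e. a `(2,1,1,0)`-morphism that also preserves the
operation taking an element to the maximum of its `σ`-class. -/
def IsFreeFBirestriction {X : Type u} {S : Type u} [BirestrictionMonoid S] (ι : X → S) : Prop :=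
  IsFBirestriction S ∧
    ∀ (T : Type v) [BirestrictionMonoid T], IsFBirestriction T → ∀ g : X → T,
      ∃! h : S →* T, IsBirestrictionHom h ∧
        (∀ s m : S, IsSigmaMax s m → IsSigmaMax (h s) (h m)) ∧ ∀ x : X, h (ι x) = g x

end BirestrictionMonoid

open BirestrictionMonoid (rstar rplus)

/-! # Inverse monoids -/

/-- Inverse monoids, by the identities that define their variety. -/
class InverseMonoid (M : Type u) extends Monoid M, InvolutiveInv M where
  mul_inv_rev' : ∀ a b : M, (a * b)⁻¹ = b⁻¹ * a⁻¹
  mul_inv_mul_self : ∀ a : M, a * a⁻¹ * a = a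
  idem_comm : ∀ a b : M, (a * a⁻¹) * (b * b⁻¹) = (b * b⁻¹) * (a * a⁻¹)

namespace InverseMonoid

/-- Every group is an inverse monoid. -/
instance ofGroup {G : Type u} [Group G] : InverseMonoid G where
  inv_inv := _root_.inv_inv
  mul_inv_rev' := _root_.mul_inv_rev
  mul_inv_mul_self a := by simp
  idem_comm a b := by simp

section
variable {M : Type u} [InverseMonoid M]

theorem idem_comm' (a b : M) : (a⁻¹ * a) * (b⁻¹ * b) = (b⁻¹ * b) * (a⁻¹ * a) := by
  simpa using idem_comm a⁻¹ b⁻¹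

theorem idem_comm'' (a b : M) : (a⁻¹ * a) * (b * b⁻¹) = (b * b⁻¹) * (a⁻¹ * a) := by
  simpa using idem_comm a⁻¹ b

theorem inv_mul_inv_self (a : M) : a⁻¹ * a * a⁻¹ = a⁻¹ := by
  simpa using mul_inv_mul_self a⁻¹

/-- The inverse of `a` is the only `b` with `a b a = a` and `b a b = b`, so that the class
above is the usual notion of an inverse monoid. -/
theorem eq_inv_of (a b : M) (h₁ : a * b * a = a) (h₂ : b * a * b = b) : b = a⁻¹ := by
  have hidem : ∀ e : M, e * e = e → e⁻¹ = e := by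
    intro e he
    have h1 : e⁻¹ * e⁻¹ = e⁻¹ := by rw [← mul_inv_rev', he]
    have h2 := idem_comm e e⁻¹
    rw [_root_.inv_inv] at h2
    have l : (e * e⁻¹) * (e⁻¹ * e) = e := by
      calc (e * e⁻¹) * (e⁻¹ * e) = e * (e⁻¹ * e⁻¹) * e := by simp only [mul_assoc]
        _ = e := by rw [h1, mul_inv_mul_self]
    have r : (e⁻¹ * e) * (e * e⁻¹) = e⁻¹ := by
      calc (e⁻¹ * e) * (e * e⁻¹) = e⁻¹ * (e * e) * e⁻¹ := by simp only [mul_assoc]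
        _ = e⁻¹ := by rw [he, inv_mul_inv_self]
    rw [l, r] at h2
    exact h2.symm
  have hab : (a * b) * (a * b) = a * b := by rw [← mul_assoc, h₁]
  have hba : (b * a) * (b * a) = b * a := by rw [← mul_assoc, h₂]
  have e1 : b⁻¹ * a⁻¹ = a * b := by rw [← mul_inv_rev', hidem _ hab]
  have e1' : a⁻¹ * b⁻¹ = b * a := by rw [← mul_inv_rev', hidem _ hba]
  have c1 : b * a = a⁻¹ * a := by
    have k1 : (a⁻¹ * a) * (b * a) = a⁻¹ * a := by
      rw [mul_assoc, ← mul_assoc a, h₁]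
    have k2 : (b * a) * (a⁻¹ * a) = b * a := by
      rw [mul_assoc, ← mul_assoc a, mul_inv_mul_self]
    have k3 : (a⁻¹ * a) * (b * a) = (b * a) * (a⁻¹ * a) := by
      have := idem_comm' a (b * a)
      rwa [hidem _ hba, hba] at this
    rw [← k2, ← k3, k1]
  have c2 : a * b = a * a⁻¹ := by
    have k1 : (a * b) * (a * a⁻¹) = a * a⁻¹ := by
      rw [← mul_assoc, h₁]
    have k2 : (a * a⁻¹) * (a * b) = a * b := by
      rw [← mul_assoc, mul_inv_mul_self]
    have k3 : (a * b) * (a * a⁻¹) = (a * a⁻¹) * (a * b) := by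
      have := idem_comm (a * b) a
      rwa [hidem _ hab, hab] at this
    rw [← k2, ← k3, k1]
  calc b = b * a * b := h₂.symm
    _ = a⁻¹ * (a * b) := by rw [c1, mul_assoc]
    _ = a⁻¹ := by rw [c2, ← mul_assoc, inv_mul_inv_self]

end

/-- An inverse monoid is a birestriction monoid with `x^* = x⁻¹ x` and `x^+ = x x⁻¹`. -/
instance toBirestrictionMonoid {M : Type u} [InverseMonoid M] : BirestrictionMonoid M where
  rstar x := x⁻¹ * x
  rplus x := x * x⁻¹
  mul_rstar_self x := by rw [← mul_assoc, mul_inv_mul_self]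
  rstar_mul_comm := idem_comm'
  rstar_mul_rstar x y := by
    have h : (y⁻¹ * y) * (y⁻¹ * y) = y⁻¹ * y := by rw [← mul_assoc, inv_mul_inv_self]
    calc (x * (y⁻¹ * y))⁻¹ * (x * (y⁻¹ * y))
        = ((y⁻¹ * y) * (x⁻¹ * x)) * (y⁻¹ * y) := by
          simp only [mul_inv_rev', _root_.inv_inv, mul_assoc]
      _ = x⁻¹ * x * (y⁻¹ * y) := by rw [← idem_comm' x y, mul_assoc, h]
  rstar_mul x y := by
    calc x⁻¹ * x * y = (x⁻¹ * x) * (y * y⁻¹) * y := by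
          rw [mul_assoc (x⁻¹ * x), mul_inv_mul_self]
      _ = (y * y⁻¹) * (x⁻¹ * x) * y := by rw [idem_comm'']
      _ = y * ((x * y)⁻¹ * (x * y)) := by simp only [mul_inv_rev', mul_assoc]
  rplus_mul_self := mul_inv_mul_self
  rplus_mul_comm := idem_comm
  rplus_mul_rplus x y := by
    have h : (x * x⁻¹) * (x * x⁻¹) = x * x⁻¹ := by rw [← mul_assoc, mul_inv_mul_self]
    calc (x * x⁻¹ * y) * (x * x⁻¹ * y)⁻¹
        = (x * x⁻¹) * ((y * y⁻¹) * (x * x⁻¹)) := by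
          simp only [mul_inv_rev', _root_.inv_inv, mul_assoc]
      _ = x * x⁻¹ * (y * y⁻¹) := by rw [← idem_comm x y, ← mul_assoc, h]
  mul_rplus x y := by
    calc x * (y * y⁻¹) = x * ((x⁻¹ * x) * (y * y⁻¹)) := by
          rw [← mul_assoc x (x⁻¹ * x), ← mul_assoc x x⁻¹, mul_inv_mul_self]
      _ = x * ((y * y⁻¹) * (x⁻¹ * x)) := by rw [idem_comm'']
      _ = (x * y) * (x * y)⁻¹ * x := by simp only [mul_inv_rev', mul_assoc]
  rstar_rplus x := by
    rw [mul_inv_rev', _root_.inv_inv, ← mul_assoc, mul_inv_mul_self]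
  rplus_rstar x := by
    rw [mul_inv_rev', _root_.inv_inv, ← mul_assoc, inv_mul_inv_self]

/-- `M` is `Y`-generated as an inverse monoid via the assignment map `ι`. -/
def IsGenerated {Y : Type v} {M : Type u} [InverseMonoid M] (ι : Y → M) : Prop :=
  ∀ A : Set M, (∀ y, ι y ∈ A) → (1 : M) ∈ A → (∀ s ∈ A, ∀ t ∈ A, s * t ∈ A) →
    (∀ s ∈ A, s⁻¹ ∈ A) → A = Set.univ

/-- `E`-unitary inverse monoids: every element above an idempotent is an idempotent. -/
def IsEUnitary (M : Type u) [InverseMonoid M] : Prop :=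
  ∀ e s : M, IsIdempotentElem e → BirestrictionMonoid.NatLE e s → IsIdempotentElem s

end InverseMonoid

/-- The birestriction monoid `S`, generated by `Y` via `ι`, admits a geometric model: it
`Y`-canonically `(2,1,1,0)`-embeds into a `Y`-generated `E`-unitary inverse monoid. -/
def AdmitsGeometricModel {Y : Type u} {S : Type u} [BirestrictionMonoid S] (ι : Y → S) : Prop :=
  ∃ (U : Type v) (_ : InverseMonoid U) (j : Y → U),
    InverseMonoid.IsGenerated j ∧ InverseMonoid.IsEUnitary U ∧
      ∃ f : S →* U, BirestrictionMonoid.IsBirestrictionHom f ∧ Function.Injective f ∧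
        ∀ y : Y, f (ι y) = j y

/-! # Presentations -/

/-- Terms over `Y` in the signature `(·, *, +, 1)`. -/
inductive BTerm (Y : Type u) : Type u
  | of (y : Y) : BTerm Y
  | one : BTerm Y
  | mul (s t : BTerm Y) : BTerm Y
  | star (s : BTerm Y) : BTerm Y
  | plus (s : BTerm Y) : BTerm Y

/-- The least congruence on terms which contains `R` and all instances of the defining
identities of birestriction monoids. -/
inductive BRel {Y : Type u} (R : BTerm Y → BTerm Y → Prop) : BTerm Y → BTerm Y → Prop
  | rel {s t : BTerm Y} : R s t → BRel R s t
  | refl (s : BTerm Y) : BRel R s s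
  | symm {s t : BTerm Y} : BRel R s t → BRel R t s
  | trans {s t r : BTerm Y} : BRel R s t → BRel R t r → BRel R s r
  | mul_congr {s s' t t' : BTerm Y} : BRel R s s' → BRel R t t' → BRel R (s.mul t) (s'.mul t')
  | star_congr {s s' : BTerm Y} : BRel R s s' → BRel R s.star s'.star
  | plus_congr {s s' : BTerm Y} : BRel R s s' → BRel R s.plus s'.plus
  | mul_assoc (s t r : BTerm Y) : BRel R ((s.mul t).mul r) (s.mul (t.mul r))
  | one_mul (s : BTerm Y) : BRel R (BTerm.one.mul s) s
  | mul_one (s : BTerm Y) : BRel R (s.mul BTerm.one) s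
  | mul_star_self (x : BTerm Y) : BRel R (x.mul x.star) x
  | star_mul_comm (x y : BTerm Y) : BRel R (x.star.mul y.star) (y.star.mul x.star)
  | star_mul_star (x y : BTerm Y) : BRel R (x.mul y.star).star (x.star.mul y.star)
  | star_mul (x y : BTerm Y) : BRel R (x.star.mul y) (y.mul (x.mul y).star)
  | plus_mul_self (x : BTerm Y) : BRel R (x.plus.mul x) x
  | plus_mul_comm (x y : BTerm Y) : BRel R (x.plus.mul y.plus) (y.plus.mul x.plus)
  | plus_mul_plus (x y : BTerm Y) : BRel R (x.plus.mul y).plus (x.plus.mul y.plus)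
  | mul_plus (x y : BTerm Y) : BRel R (x.mul y.plus) ((x.mul y).plus.mul x)
  | star_plus (x : BTerm Y) : BRel R x.plus.star x.plus
  | plus_star (x : BTerm Y) : BRel R x.star.plus x.star

/-- The birestriction monoid `BRestr⟨Y | R⟩` presented by generators `Y` and relations `R`. -/
def BRestr {Y : Type u} (R : BTerm Y → BTerm Y → Prop) : Type u :=
  Quotient (⟨BRel R, BRel.refl, BRel.symm, BRel.trans⟩ : Setoid (BTerm Y))

namespace BRestr
variable {Y : Type u} {R : BTerm Y → BTerm Y → Prop}

/-- The value of a term in `BRestr⟨Y | R⟩`. -/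
def mk (R : BTerm Y → BTerm Y → Prop) (t : BTerm Y) : BRestr R := Quotient.mk _ t

/-- The assignment map of `BRestr⟨Y | R⟩`. -/
def of (R : BTerm Y → BTerm Y → Prop) (y : Y) : BRestr R := mk R (BTerm.of y)

instance : BirestrictionMonoid (BRestr R) where
  one := mk R BTerm.one
  mul := Quotient.map₂ BTerm.mul fun _ _ h _ _ h' => BRel.mul_congr h h'
  rstar := Quotient.map BTerm.star fun _ _ h => BRel.star_congr h
  rplus := Quotient.map BTerm.plus fun _ _ h => BRel.plus_congr h
  mul_assoc := by rintro ⟨a⟩ ⟨b⟩ ⟨c⟩; exact Quotient.sound (BRel.mul_assoc a b c)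
  one_mul := by rintro ⟨a⟩; exact Quotient.sound (BRel.one_mul a)
  mul_one := by rintro ⟨a⟩; exact Quotient.sound (BRel.mul_one a)
  mul_rstar_self := by rintro ⟨a⟩; exact Quotient.sound (BRel.mul_star_self a)
  rstar_mul_comm := by rintro ⟨a⟩ ⟨b⟩; exact Quotient.sound (BRel.star_mul_comm a b)
  rstar_mul_rstar := by rintro ⟨a⟩ ⟨b⟩; exact Quotient.sound (BRel.star_mul_star a b)
  rstar_mul := by rintro ⟨a⟩ ⟨b⟩; exact Quotient.sound (BRel.star_mul a b)
  rplus_mul_self := by rintro ⟨a⟩; exact Quotient.sound (BRel.plus_mul_self a)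
  rplus_mul_comm := by rintro ⟨a⟩ ⟨b⟩; exact Quotient.sound (BRel.plus_mul_comm a b)
  rplus_mul_rplus := by rintro ⟨a⟩ ⟨b⟩; exact Quotient.sound (BRel.plus_mul_plus a b)
  mul_rplus := by rintro ⟨a⟩ ⟨b⟩; exact Quotient.sound (BRel.mul_plus a b)
  rstar_rplus := by rintro ⟨a⟩; exact Quotient.sound (BRel.star_plus a)
  rplus_rstar := by rintro ⟨a⟩; exact Quotient.sound (BRel.plus_star a)

/-- `BRestr⟨Y | R⟩` is `Y`-generated. -/
theorem isGenerated : BirestrictionMonoid.IsGenerated (of R) := by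
  intro A hof h1 hmul hstar hplus
  refine Set.eq_univ_of_forall ?_
  rintro ⟨t⟩
  change mk R t ∈ A
  induction t with
  | of y => exact hof y
  | one => exact h1
  | mul s t hs ht => exact hmul _ hs _ ht
  | star s hs => exact hstar _ hs
  | plus s hs => exact hplus _ hs

end BRestr

/-- Terms over `Y` in the signature `(·, ⁻¹, 1)`. -/
inductive ITerm (Y : Type u) : Type u
  | of (y : Y) : ITerm Y
  | one : ITerm Y
  | mul (s t : ITerm Y) : ITerm Y
  | inv (s : ITerm Y) : ITerm Y

/-- The value of a term in an inverse monoid `M` with the assignment map `f : Y → M`. -/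
def ITerm.eval {Y : Type u} {M : Type v} [InverseMonoid M] (f : Y → M) : ITerm Y → M
  | .of y => f y
  | .one => 1
  | .mul s t => ITerm.eval f s * ITerm.eval f t
  | .inv s => (ITerm.eval f s)⁻¹

/-- The least congruence on terms which contains `R` and all instances of the defining
identities of inverse monoids. -/
inductive IRel {Y : Type u} (R : ITerm Y → ITerm Y → Prop) : ITerm Y → ITerm Y → Prop
  | rel {s t : ITerm Y} : R s t → IRel R s t
  | refl (s : ITerm Y) : IRel R s s
  | symm {s t : ITerm Y} : IRel R s t → IRel R t s
  | trans {s t r : ITerm Y} : IRel R s t → IRel R t r → IRel R s r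
  | mul_congr {s s' t t' : ITerm Y} : IRel R s s' → IRel R t t' → IRel R (s.mul t) (s'.mul t')
  | inv_congr {s s' : ITerm Y} : IRel R s s' → IRel R s.inv s'.inv
  | mul_assoc (s t r : ITerm Y) : IRel R ((s.mul t).mul r) (s.mul (t.mul r))
  | one_mul (s : ITerm Y) : IRel R (ITerm.one.mul s) s
  | mul_one (s : ITerm Y) : IRel R (s.mul ITerm.one) s
  | inv_inv (s : ITerm Y) : IRel R s.inv.inv s
  | mul_inv_rev (s t : ITerm Y) : IRel R (s.mul t).inv (t.inv.mul s.inv)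
  | mul_inv_mul_self (s : ITerm Y) : IRel R ((s.mul s.inv).mul s) s
  | idem_comm (s t : ITerm Y) :
      IRel R ((s.mul s.inv).mul (t.mul t.inv)) ((t.mul t.inv).mul (s.mul s.inv))

/-- The inverse monoid `Inv⟨Y | R⟩` presented by generators `Y` and relations `R`. -/
def InvPres {Y : Type u} (R : ITerm Y → ITerm Y → Prop) : Type u :=
  Quotient (⟨IRel R, IRel.refl, IRel.symm, IRel.trans⟩ : Setoid (ITerm Y))

namespace InvPres
variable {Y : Type u} {R : ITerm Y → ITerm Y → Prop}

/-- The value of a term in `Inv⟨Y | R⟩`. -/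
def mk (R : ITerm Y → ITerm Y → Prop) (t : ITerm Y) : InvPres R := Quotient.mk _ t

/-- The assignment map of `Inv⟨Y | R⟩`. -/
def of (R : ITerm Y → ITerm Y → Prop) (y : Y) : InvPres R := mk R (ITerm.of y)

instance : InverseMonoid (InvPres R) where
  one := mk R ITerm.one
  mul := Quotient.map₂ ITerm.mul fun _ _ h _ _ h' => IRel.mul_congr h h'
  inv := Quotient.map ITerm.inv fun _ _ h => IRel.inv_congr h
  mul_assoc := by rintro ⟨a⟩ ⟨b⟩ ⟨c⟩; exact Quotient.sound (IRel.mul_assoc a b c)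
  one_mul := by rintro ⟨a⟩; exact Quotient.sound (IRel.one_mul a)
  mul_one := by rintro ⟨a⟩; exact Quotient.sound (IRel.mul_one a)
  inv_inv := by rintro ⟨a⟩; exact Quotient.sound (IRel.inv_inv a)
  mul_inv_rev' := by rintro ⟨a⟩ ⟨b⟩; exact Quotient.sound (IRel.mul_inv_rev a b)
  mul_inv_mul_self := by rintro ⟨a⟩; exact Quotient.sound (IRel.mul_inv_mul_self a)
  idem_comm := by rintro ⟨a⟩ ⟨b⟩; exact Quotient.sound (IRel.idem_comm a b)

theorem eval_eq_of_rel {M : Type v} [InverseMonoid M] (f : Y → M)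
    (hf : ∀ s t, R s t → ITerm.eval f s = ITerm.eval f t) {s t : ITerm Y} (h : IRel R s t) :
    ITerm.eval f s = ITerm.eval f t := by
  induction h with
  | rel h => exact hf _ _ h
  | refl s => rfl
  | symm _ ih => exact ih.symm
  | trans _ _ ih₁ ih₂ => exact ih₁.trans ih₂
  | mul_congr _ _ ih₁ ih₂ => simp only [ITerm.eval, ih₁, ih₂]
  | inv_congr _ ih => simp only [ITerm.eval, ih]
  | mul_assoc s t r => simp only [ITerm.eval, _root_.mul_assoc]
  | one_mul s => simp only [ITerm.eval, _root_.one_mul]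
  | mul_one s => simp only [ITerm.eval, _root_.mul_one]
  | inv_inv s => simp only [ITerm.eval, _root_.inv_inv]
  | mul_inv_rev s t => simp only [ITerm.eval, InverseMonoid.mul_inv_rev']
  | mul_inv_mul_self s => simp only [ITerm.eval, InverseMonoid.mul_inv_mul_self]
  | idem_comm s t => exact InverseMonoid.idem_comm _ _

/-- The canonical morphism from `Inv⟨Y | R⟩` to an inverse monoid in which `R` holds. -/
def lift {M : Type v} [InverseMonoid M] (f : Y → M)
    (hf : ∀ s t, R s t → ITerm.eval f s = ITerm.eval f t) : InvPres R →* M where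
  toFun := Quotient.lift (ITerm.eval f) fun _ _ h => eval_eq_of_rel f hf h
  map_one' := rfl
  map_mul' := by rintro ⟨a⟩ ⟨b⟩; rfl

end InvPres

/-- The canonical map `ψ` from birestriction terms to inverse monoid terms; it is the identity
on generators, and takes `t^*` to `t⁻¹ t` and `t^+` to `t t⁻¹`. -/
def BTerm.psi {Y : Type u} : BTerm Y → ITerm Y
  | .of y => .of y
  | .one => .one
  | .mul s t => s.psi.mul t.psi
  | .star s => s.psi.inv.mul s.psi
  | .plus s => s.psi.mul s.psi.inv

/-- The universal inverse monoid `Inv⟨Y | ψ(R)⟩` of `BRestr⟨Y | R⟩`. -/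
abbrev UnivInv {Y : Type u} (R : BTerm Y → BTerm Y → Prop) : Type u :=
  InvPres (Relation.Map R BTerm.psi BTerm.psi)

/-! # The monoids `F` and `I` -/

/-- The extended set of generators `X ∪ X̄⁺`, where `X⁺` is the free semigroup over `X`:
`Sum.inl x` is `x` and `Sum.inr u` is `ū`. -/
abbrev ExtGen (X : Type u) : Type u := X ⊕ FreeSemigroup X

/-- The relations `N`: `x̄ ≥ x`, i.e. `x = x̄ x^*`, for `x ∈ X`, and `(uv)‾ ≥ ū v̄`, i.e.
`ū v̄ = (uv)‾ (ū v̄)^*`, for `u, v ∈ X⁺`. -/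
inductive RelN (X : Type u) : BTerm (ExtGen X) → BTerm (ExtGen X) → Prop
  | gen (x : X) :
      RelN X (.of (.inl x)) ((BTerm.of (.inr (FreeSemigroup.of x))).mul (BTerm.of (.inl x)).star)
  | mul (u v : FreeSemigroup X) :
      RelN X ((BTerm.of (.inr u)).mul (.of (.inr v)))
        ((BTerm.of (.inr (u * v))).mul ((BTerm.of (.inr u)).mul (.of (.inr v))).star)

/-- The birestriction monoid `F = F_∅ = BRestr⟨X ∪ X̄⁺ | N⟩`. -/
abbrev MonoidF (X : Type u) : Type u := BRestr (RelN X)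

/-- The inverse monoid `I = Inv⟨X ∪ X̄⁺ | ψ(N)⟩`, the universal inverse monoid of `F`. -/
abbrev MonoidI (X : Type u) : Type u := UnivInv (RelN X)

namespace MonoidI
variable {X : Type u}

/-- The value of the generator `ū` in `I`, for `u ∈ X⁺`. -/
def bar (u : FreeSemigroup X) : MonoidI X := InvPres.of _ (Sum.inr u)

/-- The canonical morphism from `I` to the free group over `X`, determined by
`x ↦ x` for `x ∈ X` and `ū ↦ u` for `u ∈ X⁺`. -/
def toFreeGroup : MonoidI X →* FreeGroup X :=
  InvPres.lift (Sum.elim FreeGroup.of (FreeSemigroup.lift FreeGroup.of)) <| by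
    rintro _ _ ⟨s, t, h, rfl, rfl⟩
    cases h <;> simp [BTerm.psi, ITerm.eval]

end MonoidI

/-! Freeness: sending `x` and `ū` to `u` gives a morphism `degree` from `F` to the free monoid, and
every `s` lies below `barOne (degree s)`. Hence `σ` is the kernel of `degree`, the elements `1` and
`ū` are the maxima of its classes, and an extension to an `F`-birestriction monoid must send `ū` to
the maximum of the class of the image of `u`. The relations `N` are exactly the inequalities which
such maxima satisfy.

No geometric model: put `c = x`, `a = x̄` and let `b` be the generator for `x²`, so that `c ≤ a` and
`c c ≤ a a ≤ b`. In an `E`-unitary inverse monoid `a b⁻¹ a` lies above the idempotent `c (c c)⁻¹ c`,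
so it is idempotent, and this forces `a^+ b a^* = a a` (`rplus_mul_mul_rstar_eq`). That equation
involves only `·`, `*`, `+`, so an embedding would reflect it to `F`. A model by partial bijections
of four points satisfies `N` but refutes both the equation in `F` and the idempotency of `a b⁻¹ a`
in `I`. -/

namespace BirestrictionMonoid

/-! ### Natural order, `σ` and maxima of `σ`-classes -/

section
variable {S : Type u} [BirestrictionMonoid S] {s t r s' t' m n e f : S}

theorem rstar_one : rstar (1 : S) = 1 := by
  simpa using mul_rstar_self (1 : S)

theorem rstar_rstar (s : S) : rstar (rstar s) = rstar s := by
  rw [← rplus_rstar s, rstar_rplus]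

theorem isProjection_rstar (s : S) : IsProjection (rstar s) := ⟨s, rfl⟩

theorem isProjection_rplus (s : S) : IsProjection (rplus s) := ⟨rplus s, (rstar_rplus s).symm⟩

theorem isProjection_one : IsProjection (1 : S) := ⟨1, rstar_one.symm⟩

namespace IsProjection

theorem rstar_eq (he : IsProjection e) : rstar e = e := by
  obtain ⟨s, rfl⟩ := he
  exact rstar_rstar s

theorem rplus_eq (he : IsProjection e) : rplus e = e := by
  obtain ⟨s, rfl⟩ := he
  exact rplus_rstar s

theorem mul_self (he : IsProjection e) : e * e = e := by
  simpa only [he.rstar_eq] using mul_rstar_self e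

theorem mul (he : IsProjection e) (hf : IsProjection f) : IsProjection (e * f) := by
  obtain ⟨s, rfl⟩ := he
  obtain ⟨t, rfl⟩ := hf
  exact ⟨s * rstar t, (rstar_mul_rstar s t).symm⟩

theorem mul_comm (he : IsProjection e) (hf : IsProjection f) : e * f = f * e := by
  obtain ⟨s, rfl⟩ := he
  obtain ⟨t, rfl⟩ := hf
  exact rstar_mul_comm s t

end IsProjection

/-- The order is left-right symmetric, since projections can be moved across `t`. The right-hand
form is the one in which `N` is written. -/
theorem natLE_iff_eq_mul_rstar : NatLE s t ↔ s = t * rstar s := by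
  constructor
  · rintro ⟨e, he, rfl⟩
    conv_lhs => rw [← he.rstar_eq, rstar_mul]
  · intro h
    refine ⟨rplus (t * rstar s), isProjection_rplus _, ?_⟩
    rw [← mul_rplus, rplus_rstar]
    exact h

theorem NatLE.refl (s : S) : NatLE s s := ⟨1, isProjection_one, (one_mul s).symm⟩

theorem NatLE.trans (h : NatLE s t) (h' : NatLE t r) : NatLE s r := by
  obtain ⟨e, he, rfl⟩ := h
  obtain ⟨f, hf, rfl⟩ := h'
  exact ⟨e * f, he.mul hf, (mul_assoc e f r).symm⟩

theorem NatLE.antisymm (h : NatLE s t) (h' : NatLE t s) : s = t := by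
  obtain ⟨e, he, h⟩ := h
  obtain ⟨f, hf, h'⟩ := h'
  have ht : t = e * (f * t) := by
    rw [← mul_assoc, he.mul_comm hf, mul_assoc, ← h, ← h']
  calc s = e * t := h
    _ = e * (e * (f * t)) := by rw [← ht]
    _ = t := by rw [← mul_assoc e e, he.mul_self, ← ht]

theorem NatLE.mul (h : NatLE s t) (h' : NatLE s' t') : NatLE (s * s') (t * t') := by
  obtain ⟨e, he, rfl⟩ := h
  obtain ⟨f, hf, rfl⟩ := h'
  refine ⟨e * rplus (t * f), he.mul (isProjection_rplus _), ?_⟩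
  calc e * t * (f * t') = e * (t * rplus f) * t' := by rw [hf.rplus_eq]; simp only [mul_assoc]
    _ = e * rplus (t * f) * (t * t') := by rw [mul_rplus]; simp only [mul_assoc]

theorem IsProjection.natLE_one (he : IsProjection e) : NatLE e 1 := ⟨e, he, (mul_one e).symm⟩

/-- This makes `1` the maximum of its own `σ`-class whenever that class has a maximum. -/
theorem eq_one_of_one_natLE (h : NatLE 1 s) : s = 1 := by
  obtain ⟨e, he, h⟩ := h
  have : e = 1 := by
    calc e = e * (e * s) := by rw [← h, mul_one]
      _ = 1 := by rw [← mul_assoc, he.mul_self, ← h]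
  rw [this, one_mul] at h
  exact h.symm

theorem Sigma.refl (s : S) : Sigma s s := ⟨1, isProjection_one, rfl⟩

theorem Sigma.symm (h : Sigma s t) : Sigma t s := by
  obtain ⟨e, he, h⟩ := h
  exact ⟨e, he, h.symm⟩

theorem Sigma.trans (h : Sigma s t) (h' : Sigma t r) : Sigma s r := by
  obtain ⟨e, he, h⟩ := h
  obtain ⟨f, hf, h'⟩ := h'
  refine ⟨e * f, he.mul hf, ?_⟩
  calc e * f * s = f * (e * s) := by rw [he.mul_comm hf, mul_assoc]
    _ = e * (f * t) := by rw [h, ← mul_assoc, ← he.mul_comm hf, mul_assoc]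
    _ = e * f * r := by rw [h', mul_assoc]

theorem NatLE.sigma (h : NatLE s t) : Sigma s t := by
  obtain ⟨e, he, rfl⟩ := h
  exact ⟨e, he, by rw [← mul_assoc, he.mul_self]⟩

theorem Sigma.exists_natLE (h : Sigma s t) : ∃ r, NatLE r s ∧ NatLE r t := by
  obtain ⟨e, he, h⟩ := h
  exact ⟨e * s, ⟨e, he, rfl⟩, ⟨e, he, h⟩⟩

theorem Sigma.mul (h : Sigma s t) (h' : Sigma s' t') : Sigma (s * s') (t * t') := by
  obtain ⟨r, hs, ht⟩ := h.exists_natLE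
  obtain ⟨r', hs', ht'⟩ := h'.exists_natLE
  exact (hs.mul hs').sigma.symm.trans (ht.mul ht').sigma

theorem IsSigmaMax.natLE (h : IsSigmaMax s m) : NatLE s m := h.2 s (Sigma.refl s)

theorem IsSigmaMax.congr (h : IsSigmaMax s m) (hst : Sigma s t) : IsSigmaMax t m :=
  ⟨h.1.trans hst, fun r hr => h.2 r (hr.trans hst.symm)⟩

theorem IsSigmaMax.unique (h : IsSigmaMax s m) (h' : IsSigmaMax s n) : m = n :=
  (h'.2 m h.1).antisymm (h.2 n h'.1)

theorem IsSigmaMax.mul_natLE (h : IsSigmaMax s m) (h' : IsSigmaMax t n)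
    (hst : IsSigmaMax (s * t) r) : NatLE (m * n) r :=
  hst.2 _ (h.1.mul h'.1)

theorem IsFBirestriction.isSigmaMax_one (hS : IsFBirestriction S) : IsSigmaMax (1 : S) 1 := by
  obtain ⟨m, hm⟩ := hS 1
  rwa [eq_one_of_one_natLE hm.natLE] at hm

end

section
variable {S : Type u} {T : Type v} [BirestrictionMonoid S] [BirestrictionMonoid T]
  {h : S →* T} {s t : S}

theorem IsBirestrictionHom.map_isProjection (hh : IsBirestrictionHom h) {e : S}
    (he : IsProjection e) : IsProjection (h e) := by
  obtain ⟨s, rfl⟩ := he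
  exact ⟨h s, hh.map_rstar s⟩

theorem IsBirestrictionHom.map_sigma (hh : IsBirestrictionHom h) (hst : Sigma s t) :
    Sigma (h s) (h t) := by
  obtain ⟨e, he, hst⟩ := hst
  exact ⟨h e, hh.map_isProjection he, by rw [← map_mul, ← map_mul, hst]⟩

theorem IsBirestrictionHom.map_natLE (hh : IsBirestrictionHom h) (hst : NatLE s t) :
    NatLE (h s) (h t) := by
  obtain ⟨e, he, rfl⟩ := hst
  exact ⟨h e, hh.map_isProjection he, map_mul h e t⟩

theorem IsGenerated.hom_ext {Y : Type*} {ι : Y → S} (hι : IsGenerated ι) {h h' : S →* T}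
    (hh : IsBirestrictionHom h) (hh' : IsBirestrictionHom h') (heq : ∀ y, h (ι y) = h' (ι y)) :
    h = h' := by
  have key := hι {s | h s = h' s} heq (by simp)
    (fun s hs t ht => by
      simp only [Set.mem_ofPred_eq] at hs ht ⊢
      rw [map_mul, map_mul, hs, ht])
    (fun s hs => by
      simp only [Set.mem_ofPred_eq] at hs ⊢
      rw [hh.map_rstar, hh'.map_rstar, hs])
    (fun s hs => by
      simp only [Set.mem_ofPred_eq] at hs ⊢
      rw [hh.map_rplus, hh'.map_rplus, hs])
  ext s
  exact (Set.ext_iff.1 key s).2 trivial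

end

/-- Every monoid is a (reduced) birestriction monoid, in which `1` is the only projection. -/
abbrev reduced (M : Type u) [Monoid M] : BirestrictionMonoid M where
  rstar _ := 1
  rplus _ := 1
  mul_rstar_self := mul_one
  rstar_mul_comm _ _ := rfl
  rstar_mul_rstar _ _ := (mul_one 1).symm
  rstar_mul x y := by rw [one_mul, mul_one]
  rplus_mul_self := one_mul
  rplus_mul_comm _ _ := rfl
  rplus_mul_rplus _ _ := (mul_one 1).symm
  mul_rplus x y := by rw [one_mul, mul_one]
  rstar_rplus _ := rfl
  rplus_rstar _ := rfl

end BirestrictionMonoid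

/-- The value of a term in a birestriction monoid `S` with the assignment map `f : Y → S`. -/
def BTerm.eval {Y : Type u} {S : Type v} [BirestrictionMonoid S] (f : Y → S) : BTerm Y → S
  | .of y => f y
  | .one => 1
  | .mul s t => s.eval f * t.eval f
  | .star s => rstar (s.eval f)
  | .plus s => rplus (s.eval f)

/-! ### Universal property of birestriction presentations -/

namespace BRestr
variable {Y : Type u} {R : BTerm Y → BTerm Y → Prop} {S : Type v} [BirestrictionMonoid S]

theorem eval_eq_of_rel (f : Y → S) (hf : ∀ s t, R s t → s.eval f = t.eval f) {s t : BTerm Y}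
    (h : BRel R s t) : s.eval f = t.eval f := by
  induction h with
  | rel h => exact hf _ _ h
  | refl s => rfl
  | symm _ ih => exact ih.symm
  | trans _ _ ih₁ ih₂ => exact ih₁.trans ih₂
  | mul_congr _ _ ih₁ ih₂ => simp only [BTerm.eval, ih₁, ih₂]
  | star_congr _ ih => simp only [BTerm.eval, ih]
  | plus_congr _ ih => simp only [BTerm.eval, ih]
  | mul_assoc s t r => exact _root_.mul_assoc _ _ _
  | one_mul s => exact _root_.one_mul _
  | mul_one s => exact _root_.mul_one _
  | mul_star_self x => exact BirestrictionMonoid.mul_rstar_self _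
  | star_mul_comm x y => exact BirestrictionMonoid.rstar_mul_comm _ _
  | star_mul_star x y => exact BirestrictionMonoid.rstar_mul_rstar _ _
  | star_mul x y => exact BirestrictionMonoid.rstar_mul _ _
  | plus_mul_self x => exact BirestrictionMonoid.rplus_mul_self _
  | plus_mul_comm x y => exact BirestrictionMonoid.rplus_mul_comm _ _
  | plus_mul_plus x y => exact BirestrictionMonoid.rplus_mul_rplus _ _
  | mul_plus x y => exact BirestrictionMonoid.mul_rplus _ _
  | star_plus x => exact BirestrictionMonoid.rstar_rplus _
  | plus_star x => exact BirestrictionMonoid.rplus_rstar _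

/-- The canonical morphism from `BRestr⟨Y | R⟩` to a birestriction monoid in which `R` holds. -/
def lift (f : Y → S) (hf : ∀ s t, R s t → s.eval f = t.eval f) : BRestr R →* S where
  toFun := Quotient.lift (BTerm.eval f) fun _ _ h => eval_eq_of_rel f hf h
  map_one' := rfl
  map_mul' := by rintro ⟨a⟩ ⟨b⟩; rfl

theorem isBirestrictionHom_lift (f : Y → S) (hf : ∀ s t, R s t → s.eval f = t.eval f) :
    BirestrictionMonoid.IsBirestrictionHom (lift f hf) where
  map_rstar := by rintro ⟨a⟩; rfl
  map_rplus := by rintro ⟨a⟩; rfl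

end BRestr

open BirestrictionMonoid in
/-- The relations `N` hold under an assignment as soon as the corresponding inequalities do. -/
theorem RelN.eval_eq {X : Type u} {S : Type v} [BirestrictionMonoid S] (f : ExtGen X → S)
    (hgen : ∀ x, NatLE (f (.inl x)) (f (.inr (FreeSemigroup.of x))))
    (hmul : ∀ u v, NatLE (f (.inr u) * f (.inr v)) (f (.inr (u * v)))) :
    ∀ s t, RelN X s t → s.eval f = t.eval f := by
  rintro _ _ (x | ⟨u, v⟩)
  · exact natLE_iff_eq_mul_rstar.1 (hgen x)
  · exact natLE_iff_eq_mul_rstar.1 (hmul u v)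

/-! ### `F` is the free `F`-birestriction monoid -/

namespace MonoidF
open BirestrictionMonoid
variable {X : Type u}

/-- The generator `x` of `F`. -/
def gen (x : X) : MonoidF X := BRestr.of _ (Sum.inl x)

/-- The generator `ū` of `F`. -/
def bar (u : FreeSemigroup X) : MonoidF X := BRestr.of _ (Sum.inr u)

theorem gen_natLE_bar (x : X) : NatLE (gen x) (bar (FreeSemigroup.of x)) :=
  natLE_iff_eq_mul_rstar.2 (Quotient.sound (BRel.rel (RelN.gen x)))

theorem bar_mul_bar_natLE (u v : FreeSemigroup X) : NatLE (bar u * bar v) (bar (u * v)) :=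
  natLE_iff_eq_mul_rstar.2 (Quotient.sound (BRel.rel (RelN.mul u v)))

/-- The extension of `u ↦ ū` to the free monoid, with `1 ↦ 1`. -/
def barOne : WithOne (FreeSemigroup X) → MonoidF X
  | none => 1
  | some u => bar u

theorem barOne_mul_natLE (u v : WithOne (FreeSemigroup X)) :
    NatLE (barOne u * barOne v) (barOne (u * v)) := by
  induction u with
  | one => rw [one_mul]; exact (one_mul (barOne v)).symm ▸ NatLE.refl _
  | coe u =>
    induction v with
    | one =>
      rw [mul_one]
      exact (mul_one (barOne (u : WithOne (FreeSemigroup X)))).symm ▸ NatLE.refl _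
    | coe v => exact bar_mul_bar_natLE u v

section degree
attribute [local instance] BirestrictionMonoid.reduced

/-- With the reduced structure on the free monoid, both inequalities of `N` become equalities. -/
theorem degree_aux : ∀ s t : BTerm (ExtGen X), RelN X s t →
    s.eval (Sum.elim (fun x => (FreeSemigroup.of x : WithOne (FreeSemigroup X))) (↑)) =
      t.eval (Sum.elim (fun x => (FreeSemigroup.of x : WithOne (FreeSemigroup X))) (↑)) :=
  RelN.eval_eq _ (fun _ => NatLE.refl _) (fun _ _ => NatLE.refl _)

/-- The morphism from `F` to the free monoid with `x ↦ x` and `ū ↦ u`. -/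
def degree : MonoidF X →* WithOne (FreeSemigroup X) := BRestr.lift _ degree_aux

theorem degree_rstar (s : MonoidF X) : degree (rstar s) = 1 :=
  (BRestr.isBirestrictionHom_lift _ degree_aux).map_rstar s

theorem degree_rplus (s : MonoidF X) : degree (rplus s) = 1 :=
  (BRestr.isBirestrictionHom_lift _ degree_aux).map_rplus s

end degree

/-- The elements with this property form a subalgebra containing the generators: products are
handled by `barOne_mul_natLE`, and projections have degree `1` and lie below `1`. -/
theorem natLE_barOne_degree (s : MonoidF X) : NatLE s (barOne (degree s)) := by
  have key := BRestr.isGenerated (R := RelN X) {s | NatLE s (barOne (degree s))}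
    (by
      rintro (x | u)
      · exact gen_natLE_bar x
      · exact NatLE.refl _)
    (NatLE.refl _)
    (fun s hs t ht => by
      simp only [Set.mem_ofPred_eq] at hs ht ⊢
      rw [map_mul]
      exact (hs.mul ht).trans (barOne_mul_natLE _ _))
    (fun s _ => by
      simp only [Set.mem_ofPred_eq, degree_rstar]
      exact (isProjection_rstar s).natLE_one)
    (fun s _ => by
      simp only [Set.mem_ofPred_eq, degree_rplus]
      exact (isProjection_rplus s).natLE_one)
  exact (Set.ext_iff.1 key s).2 trivial

/-- Projections have degree `1` and so cancel in the free monoid; conversely, elements of equal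
degree have a common upper bound. -/
theorem sigma_iff_degree_eq {s t : MonoidF X} : Sigma s t ↔ degree s = degree t := by
  constructor
  · rintro ⟨e, ⟨r, rfl⟩, h⟩
    simpa [degree_rstar] using congrArg degree h
  · intro h
    have ht := (natLE_barOne_degree t).sigma.symm
    rw [← h] at ht
    exact (natLE_barOne_degree s).sigma.trans ht

theorem isSigmaMax_barOne_degree (s : MonoidF X) : IsSigmaMax s (barOne (degree s)) := by
  refine ⟨(natLE_barOne_degree s).sigma.symm, fun t ht => ?_⟩
  rw [← sigma_iff_degree_eq.1 ht]
  exact natLE_barOne_degree t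

theorem isFBirestriction : IsFBirestriction (MonoidF X) :=
  fun s => ⟨_, isSigmaMax_barOne_degree s⟩

theorem degree_lift_gen (u : FreeSemigroup X) :
    degree (FreeSemigroup.lift gen u) = (u : WithOne (FreeSemigroup X)) := by
  induction u using FreeSemigroup.recOnMul with
  | ih1 x => rfl
  | ih2 x u hx hu => rw [map_mul, map_mul, hx, hu, WithOne.coe_mul]

/-- Expresses `ū` through the generators from `X` and the maximum operation, which determines its
image under any extension. -/
theorem isSigmaMax_lift_gen (u : FreeSemigroup X) :
    IsSigmaMax (FreeSemigroup.lift gen u) (bar u) := by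
  simpa only [degree_lift_gen] using! isSigmaMax_barOne_degree (FreeSemigroup.lift gen u)

theorem map_lift_gen {T : Type v} [BirestrictionMonoid T] {g : X → T} {h : MonoidF X →* T}
    (hg : ∀ x, h (gen x) = g x) (u : FreeSemigroup X) :
    h (FreeSemigroup.lift gen u) = FreeSemigroup.lift g u := by
  induction u using FreeSemigroup.recOnMul with
  | ih1 x => exact hg x
  | ih2 x u hx hu => rw [map_mul, map_mul, map_mul, hx, hu]

theorem exists_unique_extension {T : Type v} [BirestrictionMonoid T] (hT : IsFBirestriction T)
    (g : X → T) :
    ∃! h : MonoidF X →* T, IsBirestrictionHom h ∧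
      (∀ s m : MonoidF X, IsSigmaMax s m → IsSigmaMax (h s) (h m)) ∧ ∀ x, h (gen x) = g x := by
  choose mx hmx using hT
  let f : ExtGen X → T := Sum.elim g fun u => mx (FreeSemigroup.lift g u)
  have hf : ∀ s t, RelN X s t → s.eval f = t.eval f := by
    refine RelN.eval_eq f (fun x => (hmx (g x)).natLE) fun u v => ?_
    refine (hmx _).mul_natLE (hmx _) ?_
    rw [← map_mul]
    exact hmx _
  have hhom := BRestr.isBirestrictionHom_lift f hf
  have hgen : ∀ x, BRestr.lift f hf (gen x) = g x := fun _ => rfl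
  refine ⟨BRestr.lift f hf, ⟨hhom, fun s m hm => ?_, hgen⟩, ?_⟩
  · obtain rfl := hm.unique (isSigmaMax_barOne_degree s)
    -- The degree is split into `1` and `u ∈ X⁺`, because the maximum in degree `1` is `1` and not a
    -- generator `ū`.
    obtain ⟨w, hw⟩ : ∃ w, w = degree s := ⟨_, rfl⟩
    rw [← hw]
    induction w with
    | one =>
      have hs : Sigma 1 s := sigma_iff_degree_eq.2 (by rw [map_one, hw])
      have := hhom.map_sigma hs
      rw [map_one] at this
      exact IsSigmaMax.congr (IsFBirestriction.isSigmaMax_one fun s => ⟨_, hmx s⟩) this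
    | coe u =>
      have hs : Sigma (FreeSemigroup.lift gen u) s :=
        sigma_iff_degree_eq.2 (by rw [degree_lift_gen, hw])
      have := hhom.map_sigma hs
      rw [map_lift_gen hgen] at this
      exact (hmx _).congr this
  · rintro h ⟨hh, hmax, hg⟩
    refine IsGenerated.hom_ext BRestr.isGenerated hh hhom ?_
    rintro (x | u)
    · exact hg x
    · have := hmax _ _ (isSigmaMax_lift_gen u)
      rw [map_lift_gen hg] at this
      exact this.unique (hmx _)

theorem isFreeFBirestriction : IsFreeFBirestriction.{u, v} (gen : X → MonoidF X) :=
  ⟨isFBirestriction, fun _ _ hT g => exists_unique_extension hT g⟩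

end MonoidF

/-! # `E`-unitary inverse monoids -/

namespace InverseMonoid
open BirestrictionMonoid
variable {M : Type u} [InverseMonoid M] {a b c e s t : M}

theorem inv_eq_of_isIdempotentElem (he : IsIdempotentElem e) : e⁻¹ = e :=
  (eq_inv_of e e (by rw [he, he]) (by rw [he, he])).symm

theorem isProjection_of_isIdempotentElem (he : IsIdempotentElem e) : IsProjection e := by
  refine ⟨e, ?_⟩
  change e = e⁻¹ * e
  rw [inv_eq_of_isIdempotentElem he, he]

theorem natLE_inv (h : NatLE s t) : NatLE s⁻¹ t⁻¹ := by
  have hs := natLE_iff_eq_mul_rstar.1 h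
  refine ⟨rstar s, isProjection_rstar s, ?_⟩
  conv_lhs => rw [hs, mul_inv_rev']
  rw [inv_eq_of_isIdempotentElem (isProjection_rstar s).mul_self]

/-- By compatibility of the order with products and inverses, the element lies above `c (c c)⁻¹ c =
c^+ c^*`, a product of projections. -/
theorem IsEUnitary.isIdempotentElem_mul_inv_mul (hM : IsEUnitary M) (ha : NatLE c a)
    (hb : NatLE (c * c) b) : IsIdempotentElem (a * b⁻¹ * a) := by
  refine hM (c * (c * c)⁻¹ * c) _ ?_ ((ha.mul (natLE_inv hb)).mul ha)
  have : c * (c * c)⁻¹ * c = rplus c * rstar c := by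
    change _ = c * c⁻¹ * (c⁻¹ * c)
    simp only [mul_inv_rev', mul_assoc]
  rw [this]
  exact ((isProjection_rplus c).mul (isProjection_rstar c)).mul_self

/-- The consequence of `E`-unitarity that can be stated without inverses, hence tested in `F`. -/
theorem rplus_mul_mul_rstar_eq (hi : IsIdempotentElem (a * b⁻¹ * a)) (hab : NatLE (a * a) b) :
    rplus a * b * rstar a = a * a := by
  apply NatLE.antisymm
  · have h : rplus a * b * rstar a = a * (a * b⁻¹ * a) * a := by
      rw [← inv_eq_of_isIdempotentElem hi]
      change a * a⁻¹ * b * (a⁻¹ * a) = _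
      simp only [mul_inv_rev', _root_.inv_inv, mul_assoc]
    rw [h]
    have := ((NatLE.refl a).mul (isProjection_of_isIdempotentElem hi).natLE_one).mul (NatLE.refl a)
    rwa [mul_one] at this
  -- Multiplying `a a ≤ b` by `a^+` and `a^*` leaves the smaller side unchanged.
  · have h : rplus a * (a * a) * rstar a = a * a := by
      rw [← mul_assoc, rplus_mul_self, mul_assoc, mul_rstar_self]
    have := ((NatLE.refl (rplus a)).mul hab).mul (NatLE.refl (rstar a))
    rwa [h] at this

end InverseMonoid

/-! # A model of partial bijections -/

namespace PEquiv
variable {α : Type u}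

theorem trans_symm_comm (f g : α ≃. α) :
    (f.trans f.symm).trans (g.trans g.symm) = (g.trans g.symm).trans (f.trans f.symm) := by
  ext a b
  simp only [self_trans_symm, trans_eq_some, ofSet_eq_some_iff]
  grind

/-- The symmetric inverse monoid on `α`; partial bijections are composed from left to right. -/
instance inverseMonoid : InverseMonoid (α ≃. α) where
  one := PEquiv.refl α
  mul := PEquiv.trans
  inv := PEquiv.symm
  mul_assoc := PEquiv.trans_assoc
  one_mul := PEquiv.refl_trans
  mul_one := PEquiv.trans_refl
  inv_inv := PEquiv.symm_symm
  mul_inv_rev' := PEquiv.symm_trans_rev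
  mul_inv_mul_self f := by
    change (f.trans f.symm).trans f = f
    ext a b
    simp only [self_trans_symm, trans_eq_some, ofSet_eq_some_iff]
    grind
  idem_comm := trans_symm_comm

end PEquiv

namespace FourPointModel
open BirestrictionMonoid

/-- The partial bijection `0 ↦ 1`, `2 ↦ 3` of a four-point set. -/
def a : Fin 4 ≃. Fin 4 where
  toFun := ![some 1, none, some 3, none]
  invFun := ![none, some 0, none, some 2]
  inv := by decide

/-- The partial bijection `2 ↦ 1` of a four-point set. -/
def b : Fin 4 ≃. Fin 4 := PEquiv.single 2 1

theorem a_mul_a : a * a = ⊥ := by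
  ext i : 1
  revert i
  decide

theorem a_mul_b : a * b = ⊥ := by
  ext i : 1
  revert i
  decide

theorem b_mul_a : b * a = ⊥ := by
  ext i : 1
  revert i
  decide

theorem b_mul_b : b * b = ⊥ := by
  ext i : 1
  revert i
  decide

theorem natLE_bot (f : Fin 4 ≃. Fin 4) : NatLE ⊥ f := by
  refine ⟨⊥, ⟨⊥, ?_⟩, (PEquiv.bot_trans f).symm⟩
  exact (PEquiv.trans_bot _).symm

theorem not_isIdempotentElem : ¬ IsIdempotentElem (a * b⁻¹ * a) := by
  intro h
  -- The path `0 ↦ 1 ↦ 2 ↦ 3` through `a`, `b⁻¹`, `a` ends outside the domain of `a`, so the square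
  -- is undefined at `0`.
  have h0 : (a * b⁻¹ * a * (a * b⁻¹ * a)) 0 = (a * b⁻¹ * a) 0 := DFunLike.congr_fun h 0
  revert h0
  decide

theorem rplus_mul_mul_rstar_ne : rplus a * b * rstar a ≠ a * a := by
  intro h
  -- `b` sends `2`, in the domain of `a`, to `1`, in its range, so the left side is defined at `2`;
  -- `a a` is empty.
  have h0 : (a * a⁻¹ * b * (a⁻¹ * a)) 2 = (a * a) 2 := DFunLike.congr_fun h 2
  revert h0
  decide

variable {X : Type u}

/-- The images of the generators `ū`: `a` and `b` for `u` of length `1` and `2`, and the empty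
map otherwise. -/
def bar (u : FreeSemigroup X) : Fin 4 ≃. Fin 4 :=
  if u.length = 1 then a else if u.length = 2 then b else ⊥

/-- Hence the multiplicative relations of `N` hold whatever the value of the generator for `u v`,
and `b` may be chosen freely. -/
theorem bar_mul_bar (u v : FreeSemigroup X) : bar u * bar v = ⊥ := by
  unfold bar
  split_ifs <;>
    first
      | exact a_mul_a | exact a_mul_b | exact b_mul_a | exact b_mul_b
      | exact PEquiv.trans_bot _ | exact PEquiv.bot_trans _

/-- The images of the generators of `F` and `I`; the generators `x` are sent to the empty map. -/
def assignment : ExtGen X → (Fin 4 ≃. Fin 4) := Sum.elim (fun _ => ⊥) bar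

theorem eval_eq : ∀ s t, RelN X s t → s.eval assignment = t.eval assignment :=
  RelN.eval_eq assignment (fun _ => natLE_bot _) fun u v => by
    change NatLE (bar u * bar v) _
    rw [bar_mul_bar]
    exact natLE_bot _

end FourPointModel

/-! ### Transfer to `F` and `I`, and the conclusion -/

theorem BTerm.eval_psi {Y : Type u} {M : Type v} [InverseMonoid M] (f : Y → M) (t : BTerm Y) :
    t.psi.eval f = t.eval f := by
  induction t with
  | of y => rfl
  | one => rfl
  | mul s t hs ht => simp only [BTerm.psi, ITerm.eval, BTerm.eval, hs, ht]
  | star s hs => simp only [BTerm.psi, ITerm.eval, BTerm.eval, hs]; rfl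
  | plus s hs => simp only [BTerm.psi, ITerm.eval, BTerm.eval, hs]; rfl

theorem MonoidI.not_isIdempotentElem {X : Type u} (x : X) :
    ¬ IsIdempotentElem (MonoidI.bar (FreeSemigroup.of x) *
      (MonoidI.bar (FreeSemigroup.of x * FreeSemigroup.of x))⁻¹ *
      MonoidI.bar (FreeSemigroup.of x)) := by
  intro h
  have hf : ∀ s t, Relation.Map (RelN X) BTerm.psi BTerm.psi s t →
      s.eval FourPointModel.assignment = t.eval FourPointModel.assignment := by
    rintro _ _ ⟨s, t, h, rfl, rfl⟩
    rw [BTerm.eval_psi, BTerm.eval_psi]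
    exact FourPointModel.eval_eq s t h
  exact FourPointModel.not_isIdempotentElem (h.map (InvPres.lift _ hf))

theorem MonoidF.not_admitsGeometricModel {X : Type u} (x : X) :
    ¬ AdmitsGeometricModel.{u, v} (BRestr.of (RelN X)) := by
  rintro ⟨U, _, j, -, hU, f, hf, hinj, -⟩
  have hle := MonoidF.gen_natLE_bar x
  have hmul := MonoidF.bar_mul_bar_natLE (FreeSemigroup.of x) (FreeSemigroup.of x)
  have hmul' := hf.map_natLE hmul
  have hgen' := hf.map_natLE ((hle.mul hle).trans hmul)
  rw [map_mul] at hmul' hgen'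
  have key := InverseMonoid.rplus_mul_mul_rstar_eq
    (hU.isIdempotentElem_mul_inv_mul (hf.map_natLE hle) hgen') hmul'
  -- Both sides become images under `f`; injectivity then gives the equation in `F`, and the
  -- four-point model contradicts it.
  rw [← hf.map_rplus, ← hf.map_rstar, ← map_mul, ← map_mul, ← map_mul] at key
  exact FourPointModel.rplus_mul_mul_rstar_ne
    (congrArg (BRestr.lift _ FourPointModel.eval_eq) (hinj key))

theorem MonoidI.toFreeGroup_bar {X : Type u} (u : FreeSemigroup X) :
    MonoidI.toFreeGroup (MonoidI.bar u) = FreeSemigroup.lift FreeGroup.of u := rfl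

theorem MonoidI.toFreeGroup_inv {X : Type u} (s : MonoidI X) :
    MonoidI.toFreeGroup s⁻¹ = (MonoidI.toFreeGroup s)⁻¹ := by
  obtain ⟨t⟩ := s
  rfl

theorem mainTheorem7 {X : Type u} (x : X) (hX : ∀ y : X, y = x) :
    ¬ AdmitsGeometricModel.{u, v} (BRestr.of (RelN X)) ∧
    BirestrictionMonoid.IsFreeFBirestriction.{u, v}
      (fun y : X => BRestr.of (RelN X) (Sum.inl y)) ∧
    MonoidI.toFreeGroup (MonoidI.bar (FreeSemigroup.of x) *
      (MonoidI.bar (FreeSemigroup.of x * FreeSemigroup.of x))⁻¹ *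
      MonoidI.bar (FreeSemigroup.of x)) = 1 ∧
    ¬ IsIdempotentElem (MonoidI.bar (FreeSemigroup.of x) *
      (MonoidI.bar (FreeSemigroup.of x * FreeSemigroup.of x))⁻¹ *
      MonoidI.bar (FreeSemigroup.of x)) := by
  refine ⟨MonoidF.not_admitsGeometricModel x, MonoidF.isFreeFBirestriction, ?_,
    MonoidI.not_isIdempotentElem x⟩
  simp only [map_mul, MonoidI.toFreeGroup_inv, MonoidI.toFreeGroup_bar]
  group
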